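/- All manifolds are finite-dimensional, smooth, Hausdorff, second countable and without boundary. Let $G\rightrightarrows M$ be a Lie groupoid, with source and target submersions $s,t:G\to M$, and let $x\in M$. Write $G_x=s^{-1}(x)\cap t^{-1}(x)$ for the isotropy group at $x$ and $O_x=t(s^{-1}(x))\subset M$ for the orbit of $x$, which carries the topology of its canonical manifold structure, i.e. the quotient topology for $t:s^{-1}(x)\to O_x$. A map $f:X\to Y$ is *proper at* $y\in Y$ if every sequence $(a_n)$ in $X$ with $f(a_n)\to y$ has a convergent subsequence; it is *locally trivial at* $y$ if there are an open $V\ni y$ and a diffeomorphism $f^{-1}(V)\cong f^{-1}(y)\times V$ over $V$. The groupoid $G$ is *s-proper at* $x$ (*s-locally trivial at* $x$) if $s$ is proper (locally trivial) at $x$, and *proper at* $x$ if the map $(t,s):G\to M\times M$ is proper at $(x,x)$. A subset of $M$ is *saturated* if it is a union of orbits, and $O_x$ is *stable* if for every open $U\subset M$ containing $O_x$ there is a saturated open $V$ with $O_x\subset V\subset U$. The following are equivalent: 1. $G$ is s-proper at $x$; 2. $G$ is proper at $x$, the orbit $O_x$ is stable, and, in case $O_x$ is open in $M$, $O_x$ is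 compact; 3. $G$ is s-locally trivial at $x$, and both $G_x$ and $O_x$ are compact. -/

import Mathlib

open Set Filter Topology
open scoped Manifold ContDiff

/-- A map `f : X → Y` is *proper at* `y` if every sequence `a` in `X` with `f (a n) → y` has a
convergent subsequence. -/
def ProperAt {X Y : Type*} [TopologicalSpace X] [TopologicalSpace Y] (f : X → Y) (y : Y) : Prop :=
  ∀ a : ℕ → X, Tendsto (fun n => f (a n)) atTop (𝓝 y) →
    ∃ (p : X) (φ : ℕ → ℕ), StrictMono φ ∧ Tendsto (fun n => a (φ n)) atTop (𝓝 p)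

/-- A map `f : X → Y` of manifolds is *locally trivial at* `y`, with fibre `F = f⁻¹(y)`, if there
are an open neighbourhood `V` of `y` and a diffeomorphism `Ψ : f⁻¹(V) → F × V`, with inverse `Φ`,
whose second component is `f`. Here `f⁻¹(V)` and `F × V` are regarded as subsets of the manifolds
`X` and `X × Y`, and smoothness is smoothness on subsets; this is smoothness with respect to the
submanifold structures when `f` is a submersion, so that `F` is an embedded submanifold of `X`. -/
def LocallyTrivialAt (EX EY : Type*) {X Y : Type*}
    [NormedAddCommGroup EX] [NormedSpace ℝ EX] [NormedAddCommGroup EY] [NormedSpace ℝ EY]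
    [TopologicalSpace X] [ChartedSpace EX X] [TopologicalSpace Y] [ChartedSpace EY Y]
    (f : X → Y) (y : Y) : Prop :=
  ∃ V : Set Y, IsOpen V ∧ y ∈ V ∧
    ∃ (Ψ : X → X × Y) (Φ : X × Y → X),
      ContMDiffOn 𝓘(ℝ, EX) (𝓘(ℝ, EX).prod 𝓘(ℝ, EY)) ∞ Ψ (f ⁻¹' V) ∧
      ContMDiffOn (𝓘(ℝ, EX).prod 𝓘(ℝ, EY)) 𝓘(ℝ, EX) ∞ Φ ((f ⁻¹' {y}) ×ˢ V) ∧
      MapsTo Ψ (f ⁻¹' V) ((f ⁻¹' {y}) ×ˢ V) ∧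
      MapsTo Φ ((f ⁻¹' {y}) ×ˢ V) (f ⁻¹' V) ∧
      InvOn Φ Ψ (f ⁻¹' V) ((f ⁻¹' {y}) ×ˢ V) ∧
      ∀ g ∈ f ⁻¹' V, (Ψ g).2 = f g

/-- A *Lie groupoid* with manifold of arrows `G` (modelled on `EG`) and manifold of objects `M`
(modelled on `EM`). The source and the target are submersions. The multiplication `mul g₂ g₁` is
only meaningful (and only constrained) on the submanifold `{(g₂, g₁) | src g₂ = tgt g₁}` of `G × G`
of composable pairs, on which it is smooth. -/
structure LieGroupoid (EG EM G M : Type*)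
    [NormedAddCommGroup EG] [NormedSpace ℝ EG] [NormedAddCommGroup EM] [NormedSpace ℝ EM]
    [TopologicalSpace G] [ChartedSpace EG G] [TopologicalSpace M] [ChartedSpace EM M] where
  /-- source -/
  src : G → M
  /-- target -/
  tgt : G → M
  /-- multiplication of composable arrows -/
  mul : G → G → G
  /-- unit arrows -/
  unit : M → G
  /-- inverse arrows -/
  inv : G → G
  src_submersion : Manifold.IsSubmersion 𝓘(ℝ, EG) 𝓘(ℝ, EM) ∞ src
  tgt_submersion : Manifold.IsSubmersion 𝓘(ℝ, EG) 𝓘(ℝ, EM) ∞ tgt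
  mul_smooth : ContMDiffOn (𝓘(ℝ, EG).prod 𝓘(ℝ, EG)) 𝓘(ℝ, EG) ∞
    (fun p : G × G => mul p.1 p.2) {p : G × G | src p.1 = tgt p.2}
  unit_smooth : ContMDiff 𝓘(ℝ, EM) 𝓘(ℝ, EG) ∞ unit
  inv_smooth : ContMDiff 𝓘(ℝ, EG) 𝓘(ℝ, EG) ∞ inv
  src_mul : ∀ g₂ g₁ : G, src g₂ = tgt g₁ → src (mul g₂ g₁) = src g₁
  tgt_mul : ∀ g₂ g₁ : G, src g₂ = tgt g₁ → tgt (mul g₂ g₁) = tgt g₂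
  src_unit : ∀ x : M, src (unit x) = x
  tgt_unit : ∀ x : M, tgt (unit x) = x
  src_inv : ∀ g : G, src (inv g) = tgt g
  tgt_inv : ∀ g : G, tgt (inv g) = src g
  mul_assoc : ∀ g₃ g₂ g₁ : G, src g₃ = tgt g₂ → src g₂ = tgt g₁ →
    mul (mul g₃ g₂) g₁ = mul g₃ (mul g₂ g₁)
  mul_unit : ∀ g : G, mul g (unit (src g)) = g
  unit_mul : ∀ g : G, mul (unit (tgt g)) g = g
  mul_inv : ∀ g : G, mul g (inv g) = unit (tgt g)
  inv_mul : ∀ g : G, mul (inv g) g = unit (src g)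

namespace LieGroupoid

variable {EG EM G M : Type*}
  [NormedAddCommGroup EG] [NormedSpace ℝ EG] [NormedAddCommGroup EM] [NormedSpace ℝ EM]
  [TopologicalSpace G] [ChartedSpace EG G] [TopologicalSpace M] [ChartedSpace EM M]

/-- The `s`-fibre `G(-, x)`: the arrows with source `x`. -/
def sFiber (𝒢 : LieGroupoid EG EM G M) (x : M) : Set G := {g | 𝒢.src g = x}

/-- The isotropy group `G_x`: the arrows from `x` to `x`. -/
def isotropy (𝒢 : LieGroupoid EG EM G M) (x : M) : Set G := {g | 𝒢.src g = x ∧ 𝒢.tgt g = x}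

/-- The orbit `O_x`: the targets of the arrows with source `x`. -/
def orbit (𝒢 : LieGroupoid EG EM G M) (x : M) : Set M := 𝒢.tgt '' 𝒢.sFiber x

/-- The target map `G(-, x) → O_x`. -/
def toOrbit (𝒢 : LieGroupoid EG EM G M) (x : M) (g : 𝒢.sFiber x) : 𝒢.orbit x :=
  ⟨𝒢.tgt g, g, g.2, rfl⟩

/-- The topology of the canonical manifold structure of the orbit: the quotient topology for
`G(-, x) → O_x`, that is, for the identification of `O_x` with `G(-, x) / G_x`. It may be finer
than the subspace topology, since `O_x` need not be an embedded submanifold. -/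
abbrev orbitTopology (𝒢 : LieGroupoid EG EM G M) (x : M) : TopologicalSpace (𝒢.orbit x) :=
  TopologicalSpace.coinduced (𝒢.toOrbit x) inferInstance

/-- The orbit `O_x`, with its canonical topology, is compact. -/
def OrbitCompact (𝒢 : LieGroupoid EG EM G M) (x : M) : Prop :=
  @CompactSpace (𝒢.orbit x) (𝒢.orbitTopology x)

/-- A set of objects is *saturated* if it contains the orbit of each of its points. -/
def Saturated (𝒢 : LieGroupoid EG EM G M) (V : Set M) : Prop :=
  ∀ y ∈ V, 𝒢.orbit y ⊆ V

/-- The orbit `O_x` is *stable* if it has arbitrarily small saturated open neighbourhoods. -/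
def OrbitStable (𝒢 : LieGroupoid EG EM G M) (x : M) : Prop :=
  ∀ U : Set M, IsOpen U → 𝒢.orbit x ⊆ U →
    ∃ V : Set M, IsOpen V ∧ 𝒢.Saturated V ∧ 𝒢.orbit x ⊆ V ∧ V ⊆ U

/-- The anchor map `(t, s) : G → M × M`. -/
def anchor (𝒢 : LieGroupoid EG EM G M) (g : G) : M × M := (𝒢.tgt g, 𝒢.src g)

/-- `G` is *proper at* `x` if the anchor is proper at `(x, x)`. -/
def IsProperAt (𝒢 : LieGroupoid EG EM G M) (x : M) : Prop := ProperAt 𝒢.anchor (x, x)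

/-- `G` is *s-proper at* `x` if the source map is proper at `x`. -/
def IsSProperAt (𝒢 : LieGroupoid EG EM G M) (x : M) : Prop := ProperAt 𝒢.src x

/-- `G` is *s-locally trivial at* `x` if the source map is locally trivial at `x`. -/
def IsSLocallyTrivialAt (𝒢 : LieGroupoid EG EM G M) (x : M) : Prop :=
  LocallyTrivialAt EG EM 𝒢.src x

end LieGroupoid

/-!
Conditions 1 and 3 are related by Ehresmann's theorem at a single point `y`. If `f` is a submersion
that is proper at `y`, then the fibre `K` is compact, and every neighbourhood of `K` contains all
fibres near `K`. Composing finitely many maps, each of which slides points towards `K` in the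
coordinates of one submersion chart, gives a smooth retraction `ρ` onto `K` near `K`. By the inverse
function theorem `(ρ, f)` is a local diffeomorphism along `K`, and, being injective on the compact
set `K`, it is injective near `K`; so it trivializes `f` over a neighbourhood of `y`. Conversely,
the `s`-fibre is the total space of a principal `G_x`-bundle over `O_x`, so it is compact if `G_x`
and `O_x` are.

For 2 ⇒ 1, let `g_n` be arrows with sources tending to `x`. An orbit that is not open has empty
interior, so the `g_n` may be perturbed to have targets outside `O_x`; stability then forces these
targets to cluster at some `z ∈ O_x`, since otherwise the complement of their closure would contain
a saturated neighbourhood of `O_x`. Translating by arrows near one from `x` to `z` carries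
properness of the anchor at `(x, x)` to `(z, x)`, and a subsequence of the `g_n` converges.
-/

section Sequences

variable {X Y : Type*} [TopologicalSpace X]

theorem mapClusterPt_atTop_of_mem_closure_range [T1Space X] {u : ℕ → X} {z : X}
    (hz : z ∈ closure (range u)) (hzu : z ∉ range u) : MapClusterPt z atTop u := by
  refine mapClusterPt_atTop_iff_forall_mem_closure.2 fun n => ?_
  have hrange : range u = u '' Iio n ∪ u '' Ici n := by
    rw [← image_union, Iio_union_Ici, image_univ]
  rw [hrange, closure_union, ((finite_Iio n).image u).isClosed.closure_eq] at hz
  exact hz.resolve_left fun hmem => hzu (image_subset_range u _ hmem)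

theorem exists_seq_mem_tendsto_dist_of_dense [PseudoMetricSpace Y] {S : Set X} (hS : Dense S)
    {h : X → Y} (hh : Continuous h) (a : ℕ → X) :
    ∃ b : ℕ → X, (∀ n, b n ∈ S) ∧ Tendsto (fun n => dist (h (a n)) (h (b n))) atTop (𝓝 0) := by
  have hclose (n : ℕ) : ∃ g ∈ S, dist (h (a n)) (h g) < 1 / ((n : ℝ) + 1) := by
    have hball : ∀ᶠ g in 𝓝 (a n), dist (h (a n)) (h g) < 1 / ((n : ℝ) + 1) :=
      ((continuous_const.dist hh).tendsto (a n)).eventually_lt_const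
        (by rw [dist_self]; exact Nat.one_div_pos_of_nat)
    exact hS.inter_nhds_nonempty hball
  choose b hbS hb using hclose
  exact ⟨b, hbS, squeeze_zero (fun _ => dist_nonneg) (fun n => (hb n).le)
    tendsto_one_div_add_atTop_nhds_zero_nat⟩

end Sequences

theorem exists_isCompact_image_eq_univ {X Y : Type*} [TopologicalSpace X] [TopologicalSpace Y]
    [WeaklyLocallyCompactSpace X] [CompactSpace Y] {π : X → Y} (hπ : IsOpenMap π)
    (hsurj : Function.Surjective π) : ∃ K : Set X, IsCompact K ∧ π '' K = univ := by
  suffices ∃ K : Set X, IsCompact K ∧ univ ⊆ π '' K by simpa only [univ_subset_iff] using this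
  refine isCompact_univ.induction_on (p := fun s => ∃ K : Set X, IsCompact K ∧ s ⊆ π '' K)
    ⟨∅, isCompact_empty, empty_subset _⟩ (fun s t hst ⟨K, hK, ht⟩ => ⟨K, hK, hst.trans ht⟩)
    (fun s t ⟨K, hK, hs⟩ ⟨L, hL, ht⟩ =>
      ⟨K ∪ L, hK.union hL, by rw [image_union]; exact union_subset_union hs ht⟩) fun y _ => ?_
  obtain ⟨x, rfl⟩ := hsurj y
  obtain ⟨K, hK, hxK⟩ := exists_compact_mem_nhds x
  exact ⟨π '' K, mem_nhdsWithin_of_mem_nhds (hπ.image_mem_nhds hxK), K, hK, Subset.rfl⟩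

section InverseFunction

variable {𝕜 E F : Type*} [RCLike 𝕜] [NormedAddCommGroup E] [NormedSpace 𝕜 E]
  [NormedAddCommGroup F] [NormedSpace 𝕜 F] [CompleteSpace E]

theorem exists_openPartialHomeomorph_eventually_contDiffAt_symm {n : WithTop ℕ∞} {R : E → F} {a : E}
    (hR : ∀ᶠ w in 𝓝 a, ContDiffAt 𝕜 n R w) {A : E ≃L[𝕜] F} (hA : HasFDerivAt R (A : E →L[𝕜] F) a)
    (hn : n ≠ 0) :
    ∃ e : OpenPartialHomeomorph E F, a ∈ e.source ∧ ⇑e = R ∧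
      ∀ᶠ z in 𝓝 (R a), ContDiffAt 𝕜 n e.symm z := by
  have hRa := hR.self_of_nhds
  let e := hRa.toOpenPartialHomeomorph R hA hn
  have hea : a ∈ e.source := hRa.mem_toOpenPartialHomeomorph_source hA hn
  refine ⟨e, hea, rfl, ?_⟩
  have hequiv : ∀ᶠ w in 𝓝 a, fderiv 𝕜 R w ∈ range ((↑) : (E ≃L[𝕜] F) → (E →L[𝕜] F)) :=
    (hRa.continuousAt_fderiv hn).eventually_mem (by rw [hA.fderiv]; exact A.nhds)
  have hta : R a ∈ e.target := e.map_source hea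
  have hsymm : Tendsto e.symm (𝓝 (R a)) (𝓝 a) := e.tendsto_symm hea
  filter_upwards [e.open_target.mem_nhds hta, hsymm.eventually hR, hsymm.eventually hequiv]
    with z hz hRz ⟨B, hB⟩
  refine e.contDiffAt_symm (f₀' := B) hz ?_ hRz
  rw [hB]
  exact (hRz.differentiableAt hn).hasFDerivAt

theorem exists_contDiffAt_inverse_snd [CompleteSpace F] {n : WithTop ℕ∞} {g : E × F → F}
    {a : E × F} (hg : ∀ᶠ w in 𝓝 a, ContDiffAt 𝕜 n g w) (hn : n ≠ 0)
    (hga : ∀ᶠ v in 𝓝 a.2, g (a.1, v) = v) :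
    ∃ ψ : E × F → F, ψ a = a.2 ∧ ∀ᶠ w in 𝓝 a,
      ContDiffAt 𝕜 n ψ w ∧ g (w.1, ψ w) = w.2 ∧ ψ (w.1, g w) = w.2 := by
  let D := fderiv 𝕜 g a
  have hD : HasFDerivAt g D a := (hg.self_of_nhds.differentiableAt hn).hasFDerivAt
  have hDinr : D ∘L ContinuousLinearMap.inr 𝕜 E F = ContinuousLinearMap.id 𝕜 F :=
    (hD.comp a.2 (hasFDerivAt_prodMk_right a.1 a.2)).unique
      ((hasFDerivAt_id a.2).congr_of_eventuallyEq hga)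
  let A : (E × F) ≃L[𝕜] (E × F) := .skewProd (.refl 𝕜 E) (.refl 𝕜 F)
    (D ∘L ContinuousLinearMap.inl 𝕜 E F)
  have hA : (A : E × F →L[𝕜] E × F) = (ContinuousLinearMap.fst 𝕜 E F).prod D := by
    ext w
    · simp [A]
    · simp [A]
    · simp [A]
    · simpa [A, Prod.mk_zero_zero] using (DFunLike.congr_fun hDinr w).symm
  obtain ⟨e, hae, heR, he⟩ := exists_openPartialHomeomorph_eventually_contDiffAt_symm
    (R := fun w => (w.1, g w)) (hg.mono fun w hw => contDiffAt_fst.prodMk hw)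
    (hA ▸ hasFDerivAt_fst.prodMk hD) hn
  have heg (w : E × F) : e w = (w.1, g w) := congrFun heR w
  have hea : e a = a := (heg a).trans (Prod.ext rfl hga.self_of_nhds)
  have hat : a ∈ e.target := by simpa only [hea] using e.map_source hae
  refine ⟨fun w => (e.symm w).2, by simpa only [hea] using congrArg Prod.snd (e.left_inv hae), ?_⟩
  rw [← heg, hea] at he
  filter_upwards [he, e.open_target.mem_nhds hat, e.open_source.mem_nhds hae] with w hw hwt hws
  have hright : ((e.symm w).1, g (e.symm w)) = w := (heg _).symm.trans (e.right_inv hwt)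
  refine ⟨hw.snd, ?_, congrArg Prod.snd (heg w ▸ e.left_inv hws)⟩
  rw [← congrArg Prod.fst hright]
  exact congrArg Prod.snd hright

end InverseFunction

namespace ProperAt

variable {X Y Z : Type*} [TopologicalSpace X] [TopologicalSpace Y] [TopologicalSpace Z]
  {f : X → Y} {y : Y}

theorem of_comp {g : Y → Z} (h : ProperAt (g ∘ f) (g y)) (hg : ContinuousAt g y) : ProperAt f y :=
  fun a ha => h a (hg.tendsto.comp ha)

theorem exists_tendsto_subseq [T2Space Y] (h : ProperAt f y) (hf : Continuous f) {a : ℕ → X}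
    (ha : Tendsto (f ∘ a) atTop (𝓝 y)) :
    ∃ p ∈ f ⁻¹' {y}, ∃ φ : ℕ → ℕ, StrictMono φ ∧ Tendsto (a ∘ φ) atTop (𝓝 p) := by
  obtain ⟨p, φ, hφ, hp⟩ := h a ha
  exact ⟨p, tendsto_nhds_unique ((hf.tendsto p).comp hp) (ha.comp hφ.tendsto_atTop), φ, hφ, hp⟩

theorem isCompact_fiber [TopologicalSpace.PseudoMetrizableSpace X] [T2Space Y] (h : ProperAt f y)
    (hf : Continuous f) : IsCompact (f ⁻¹' {y}) :=
  IsSeqCompact.isCompact fun _ ha =>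
    h.exists_tendsto_subseq hf (tendsto_const_nhds.congr fun n => (ha n).symm)

theorem comap_nhds_le_nhdsSet_fiber [FirstCountableTopology Y] [T2Space Y] (h : ProperAt f y)
    (hf : Continuous f) : comap f (𝓝 y) ≤ 𝓝ˢ (f ⁻¹' {y}) := by
  refine tendsto_id'.1 (tendsto_of_subseq_tendsto fun a ha => ?_)
  obtain ⟨p, hp, φ, -, hlim⟩ := h.exists_tendsto_subseq hf (tendsto_comap_iff.1 ha)
  exact ⟨φ, hlim.mono_right (nhds_le_nhdsSet hp)⟩

theorem eventually_forall_fiber [FirstCountableTopology Y] [T2Space Y] (h : ProperAt f y)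
    (hf : Continuous f) {P : X → Prop} (hP : ∀ᶠ q in 𝓝ˢ (f ⁻¹' {y}), P q) :
    ∀ᶠ v in 𝓝 y, ∀ q, f q = v → P q :=
  eventually_comap.1 (h.comap_nhds_le_nhdsSet_fiber hf hP)

end ProperAt

theorem LocallyTrivialAt.properAt {EX EY X Y : Type*}
    [NormedAddCommGroup EX] [NormedSpace ℝ EX] [NormedAddCommGroup EY] [NormedSpace ℝ EY]
    [TopologicalSpace X] [ChartedSpace EX X] [TopologicalSpace Y] [ChartedSpace EY Y]
    [FirstCountableTopology X] {f : X → Y} {y : Y} (h : LocallyTrivialAt EX EY f y)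
    (hc : IsCompact (f ⁻¹' {y})) : ProperAt f y := by
  obtain ⟨V, hV, hyV, Ψ, Φ, -, hΦ, hΨ, -, hinv, hfst⟩ := h
  intro a ha
  obtain ⟨N, hN⟩ := eventually_atTop.1 (ha.eventually_mem (hV.mem_nhds hyV))
  have haV (n : ℕ) : a (n + N) ∈ f ⁻¹' V := hN _ (Nat.le_add_left N n)
  obtain ⟨p, hp, φ, hφ, hlim⟩ := hc.tendsto_subseq fun n => (hΨ (haV n)).1
  have hφN : StrictMono fun n => φ n + N := hφ.add_const N
  have hsnd : Tendsto (fun n => (Ψ (a (φ n + N))).2) atTop (𝓝 y) :=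
    (ha.comp hφN.tendsto_atTop).congr fun n => (hfst _ (haV _)).symm
  have hΨlim : Tendsto (fun n => Ψ (a (φ n + N))) atTop (𝓝[(f ⁻¹' {y}) ×ˢ V] (p, y)) :=
    tendsto_nhdsWithin_iff.2 ⟨hlim.prodMk_nhds hsnd, Eventually.of_forall fun n => hΨ (haV _)⟩
  exact ⟨Φ (p, y), fun n => φ n + N, hφN,
    ((hΦ.continuousOn (p, y) ⟨hp, hyV⟩).tendsto.comp hΨlim).congr fun n => hinv.1 (haV _)⟩

theorem exists_contMDiffOn_invOn {𝕜 EX EZ HX HZ X Z : Type*} [NontriviallyNormedField 𝕜]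
    [NormedAddCommGroup EX] [NormedSpace 𝕜 EX] [NormedAddCommGroup EZ] [NormedSpace 𝕜 EZ]
    [TopologicalSpace HX] [TopologicalSpace HZ]
    {I : ModelWithCorners 𝕜 EX HX} {J : ModelWithCorners 𝕜 EZ HZ} {n : WithTop ℕ∞}
    [TopologicalSpace X] [ChartedSpace HX X] [TopologicalSpace Z] [ChartedSpace HZ Z]
    {Ψ : X → Z} {U : Set X} {T : Set Z} [Nonempty X] (hU : InjOn Ψ U) (hUT : MapsTo Ψ U T)
    (hT : ∀ z ∈ T, ∃ Θ : Z → X, ContMDiffWithinAt J I n Θ T z ∧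
      ∀ᶠ z' in 𝓝[T] z, Θ z' ∈ U ∧ Ψ (Θ z') = z') :
    ∃ Φ : Z → X, ContMDiffOn J I n Φ T ∧ MapsTo Φ T U ∧ InvOn Φ Ψ U T := by
  have hsurj : SurjOn Ψ U T := fun z hz => by
    obtain ⟨Θ, -, hΘ⟩ := hT z hz
    exact ⟨Θ z, hΘ.self_of_nhdsWithin hz⟩
  have hbij : BijOn Ψ U T := ⟨hUT, hU, hsurj⟩
  have hinv := hbij.invOn_invFunOn
  refine ⟨Function.invFunOn Ψ U, fun z hz => ?_, hsurj.mapsTo_invFunOn, hinv⟩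
  obtain ⟨Θ, hΘs, hΘ⟩ := hT z hz
  have heq : Function.invFunOn Ψ U =ᶠ[𝓝[T] z] Θ := by
    filter_upwards [hΘ] with z' ⟨hmem, hz'⟩
    conv_lhs => rw [← hz', hinv.1 hmem]
  exact hΘs.congr_of_eventuallyEq heq (heq.self_of_nhdsWithin hz)

/-- Near the fibre `f⁻¹(y)` the map `ρ` is smooth, it fixes the fibre, and near those points of the
fibre that lie in `K` it takes values in the fibre. If `K`
contains the fibre, this is a smooth retraction of a neighbourhood of the fibre onto the fibre;
general `K` make it possible to build one step by step. -/
structure IsFiberRetractionNear (EX : Type*) {X Y : Type*} [NormedAddCommGroup EX]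
    [NormedSpace ℝ EX] [TopologicalSpace X] [ChartedSpace EX X] (f : X → Y) (y : Y) (K : Set X)
    (ρ : X → X) : Prop where
  eq_self : ∀ q, f q = y → ρ q = q
  eventually_contMDiffAt : ∀ p, f p = y → ∀ᶠ q in 𝓝 p, ContMDiffAt 𝓘(ℝ, EX) 𝓘(ℝ, EX) ∞ ρ q
  eventually_map_eq : ∀ p ∈ K, f p = y → ∀ᶠ q in 𝓝 p, f (ρ q) = y

namespace IsFiberRetractionNear

variable {EX X Y : Type*} [NormedAddCommGroup EX] [NormedSpace ℝ EX] [TopologicalSpace X]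
  [ChartedSpace EX X] {f : X → Y} {y : Y} {p : X} {K L : Set X} {ρ ρ₁ ρ₂ : X → X}

theorem tendsto (h : IsFiberRetractionNear EX f y K ρ) (hp : f p = y) : Tendsto ρ (𝓝 p) (𝓝 p) := by
  simpa only [ContinuousAt, h.eq_self p hp] using
    (h.eventually_contMDiffAt p hp).self_of_nhds.continuousAt

theorem mono (h : IsFiberRetractionNear EX f y L ρ) (hKL : K ⊆ L) :
    IsFiberRetractionNear EX f y K ρ :=
  ⟨h.eq_self, h.eventually_contMDiffAt, fun p hp => h.eventually_map_eq p (hKL hp)⟩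

protected theorem id : IsFiberRetractionNear EX f y ∅ id :=
  ⟨fun _ _ => rfl, fun _ _ => Eventually.of_forall fun _ => contMDiffAt_id, fun _ hp => hp.elim⟩

theorem comp (h₂ : IsFiberRetractionNear EX f y L ρ₂) (h₁ : IsFiberRetractionNear EX f y K ρ₁) :
    IsFiberRetractionNear EX f y (K ∪ L) (ρ₂ ∘ ρ₁) where
  eq_self q hq := by rw [Function.comp_apply, h₁.eq_self q hq, h₂.eq_self q hq]
  eventually_contMDiffAt p hp := by
    filter_upwards [h₁.eventually_contMDiffAt p hp,
      (h₁.tendsto hp).eventually (h₂.eventually_contMDiffAt p hp)] with q hq₁ hq₂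
    exact hq₂.comp q hq₁
  eventually_map_eq p hpKL hp := by
    rcases hpKL with hK | hL
    · filter_upwards [h₁.eventually_map_eq p hK hp] with q hq
      rw [Function.comp_apply, h₂.eq_self _ hq, hq]
    · exact (h₁.tendsto hp).eventually (h₂.eventually_map_eq p hL hp)

end IsFiberRetractionNear

/-- A pair of smooth charts, of `X` with values in `EY × F` and of `Y` with values in `EY`, in which
`f : X → Y` is the projection `EY × F → EY`. The linear equivalence `modelEquiv` records that `F`
is a complement of `EY` in the model space of `X`. -/
structure SubmersionChart (EX EY F : Type*) {X Y : Type*}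
    [NormedAddCommGroup EX] [NormedSpace ℝ EX] [NormedAddCommGroup EY] [NormedSpace ℝ EY]
    [NormedAddCommGroup F] [NormedSpace ℝ F]
    [TopologicalSpace X] [ChartedSpace EX X] [TopologicalSpace Y] [ChartedSpace EY Y]
    (f : X → Y) where
  modelEquiv : EX ≃L[ℝ] EY × F
  dom : OpenPartialHomeomorph X (EY × F)
  cod : OpenPartialHomeomorph Y EY
  contMDiffAt_dom : ∀ q ∈ dom.source, ContMDiffAt 𝓘(ℝ, EX) 𝓘(ℝ, EY × F) ∞ dom q
  contMDiffAt_dom_symm : ∀ w ∈ dom.target, ContMDiffAt 𝓘(ℝ, EY × F) 𝓘(ℝ, EX) ∞ dom.symm w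
  contMDiffAt_cod : ∀ v ∈ cod.source, ContMDiffAt 𝓘(ℝ, EY) 𝓘(ℝ, EY) ∞ cod v
  mapsTo : MapsTo f dom.source cod.source
  cod_apply : ∀ q ∈ dom.source, cod (f q) = (dom q).1

universe u in
theorem exists_submersionChart {EX : Type u} {EY X Y : Type*}
    [NormedAddCommGroup EX] [NormedSpace ℝ EX] [NormedAddCommGroup EY] [NormedSpace ℝ EY]
    [TopologicalSpace X] [ChartedSpace EX X] [TopologicalSpace Y] [ChartedSpace EY Y]
    {f : X → Y} (hf : Manifold.IsSubmersion 𝓘(ℝ, EX) 𝓘(ℝ, EY) ∞ f) (p : X) :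
    ∃ (F : Type u) (_ : NormedAddCommGroup F) (_ : NormedSpace ℝ F)
      (c : SubmersionChart EX EY F f), p ∈ c.dom.source := by
  obtain ⟨F, _, _, h⟩ := hf.isSubmersionAt p
  refine ⟨F, inferInstance, inferInstance, {
    modelEquiv := h.equiv
    dom := h.domChart.transHomeomorph h.equiv.toHomeomorph
    cod := h.codChart
    contMDiffAt_dom := fun q hq => h.equiv.contDiff.contMDiff.contMDiffAt.comp q
      (contMDiffAt_of_mem_maximalAtlas h.domChart_mem_maximalAtlas hq)
    contMDiffAt_dom_symm := fun w hw =>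
      (contMDiffAt_symm_of_mem_maximalAtlas h.domChart_mem_maximalAtlas hw).comp w
        h.equiv.symm.contDiff.contMDiff.contMDiffAt
    contMDiffAt_cod := fun v hv =>
      contMDiffAt_of_mem_maximalAtlas h.codChart_mem_maximalAtlas hv
    mapsTo := h.mapsto_domChart_source_codChart_source
    cod_apply := fun q hq => ?_ }, h.mem_domChart_source⟩
  have hq : q ∈ h.domChart.source := hq
  have htarget : h.domChart q ∈ (h.domChart.extend 𝓘(ℝ, EX)).target := by
    simpa using h.domChart.map_source hq
  simpa [h.domChart.left_inv hq] using h.writtenInCharts htarget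

section Submersion

variable {EX EY F X Y : Type*}
  [NormedAddCommGroup EX] [NormedSpace ℝ EX] [NormedAddCommGroup EY] [NormedSpace ℝ EY]
  [NormedAddCommGroup F] [NormedSpace ℝ F]
  [TopologicalSpace X] [ChartedSpace EX X] [TopologicalSpace Y] [ChartedSpace EY Y]
  {f : X → Y} {y : Y} {p : X}

namespace SubmersionChart

theorem completeSpace_prod [CompleteSpace EX] (c : SubmersionChart EX EY F f) :
    CompleteSpace (EY × F) :=
  (completeSpace_congr (e := c.modelEquiv.toEquiv) c.modelEquiv.isUniformEmbedding).1 ‹_›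

variable {c : SubmersionChart EX EY F f}

theorem map_symm_eq {w : EY × F} (hw : w ∈ c.dom.target) {v : Y} (hv : v ∈ c.cod.source)
    (h : w.1 = c.cod v) : f (c.dom.symm w) = v :=
  c.cod.injOn (c.mapsTo (c.dom.map_target hw)) hv <| by
    rw [c.cod_apply _ (c.dom.map_target hw), c.dom.right_inv hw, h]

theorem eq_of_map_eq_of_snd_eq {q q' : X} (hq : q ∈ c.dom.source) (hq' : q' ∈ c.dom.source)
    (h : f q = f q') (hsnd : (c.dom q).2 = (c.dom q').2) : q = q' :=
  c.dom.injOn hq hq' <| Prod.ext (by rw [← c.cod_apply _ hq, ← c.cod_apply _ hq', h]) hsnd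

theorem prodMk_cod_snd_dom (hp : p ∈ c.dom.source) (hfp : f p = y) :
    (c.cod y, (c.dom p).2) = c.dom p :=
  Prod.ext (hfp ▸ c.cod_apply p hp) rfl

theorem exists_local_section (hp : p ∈ c.dom.source) :
    ∃ σ : Y → X, σ (f p) = p ∧ ContinuousAt σ (f p) ∧ ∀ᶠ v in 𝓝 (f p), f (σ v) = v := by
  have hfp := c.mapsTo hp
  have hw : (c.cod (f p), (c.dom p).2) = c.dom p := prodMk_cod_snd_dom hp rfl
  have hcont : Tendsto (fun v => (c.cod v, (c.dom p).2)) (𝓝 (f p)) (𝓝 (c.dom p)) := by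
    rw [← hw]
    exact (c.cod.continuousAt hfp).prodMk continuousAt_const
  have hσp : c.dom.symm (c.cod (f p), (c.dom p).2) = p := by rw [hw, c.dom.left_inv hp]
  refine ⟨fun v => c.dom.symm (c.cod v, (c.dom p).2), hσp, ?_, ?_⟩
  · rw [ContinuousAt, hσp]
    exact (c.dom.tendsto_symm hp).comp hcont
  · filter_upwards [hcont.eventually_mem (c.dom.open_target.mem_nhds (c.dom.map_source hp)),
      c.cod.open_source.mem_nhds hfp] with v hvt hvs
    exact map_symm_eq hvt hvs rfl

end SubmersionChart

theorem exists_local_section_of_isSubmersion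
    (hf : Manifold.IsSubmersion 𝓘(ℝ, EX) 𝓘(ℝ, EY) ∞ f) (p : X) :
    ∃ σ : Y → X, σ (f p) = p ∧ ContinuousAt σ (f p) ∧ ∀ᶠ v in 𝓝 (f p), f (σ v) = v := by
  obtain ⟨F, _, _, c, hp⟩ := exists_submersionChart hf p
  exact c.exists_local_section hp

theorem isOpenMap_of_isSubmersion (hf : Manifold.IsSubmersion 𝓘(ℝ, EX) 𝓘(ℝ, EY) ∞ f) :
    IsOpenMap f := by
  refine IsOpenMap.of_nhds_le fun p => ?_
  obtain ⟨σ, hσp, hσ, hfσ⟩ := exists_local_section_of_isSubmersion hf p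
  calc 𝓝 (f p) = map f (map σ (𝓝 (f p))) := by
        rw [Filter.map_map]
        exact ((Filter.map_congr hfσ).trans Filter.map_id).symm
    _ ≤ map f (𝓝 p) := Filter.map_mono (by simpa only [ContinuousAt, Tendsto, hσp] using hσ)

namespace SubmersionChart

variable (c : SubmersionChart EX EY F f) {χ : X → ℝ}

/-- The coordinates in the submersion chart `c` of the point obtained from `q` by moving the
fraction `χ q` of the way towards the fibre `f⁻¹(y)`. -/
def slideCoord (χ : X → ℝ) (y : Y) (q : X) : EY × F :=
  c.dom q + (χ q • (c.cod y - (c.dom q).1), 0)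

open Classical in
/-- The self-map of `X` that moves each point `q` of the chart domain of `c` the fraction `χ q` of
the way towards the fibre `f⁻¹(y)`, and fixes all other points. -/
noncomputable def slide (χ : X → ℝ) (y : Y) (q : X) : X :=
  if q ∈ c.dom.source then c.dom.symm (c.slideCoord χ y q) else q

variable {c} {q : X}

theorem slide_of_mem (hq : q ∈ c.dom.source) : c.slide χ y q = c.dom.symm (c.slideCoord χ y q) :=
  if_pos hq

theorem slideCoord_eq_dom (hq : q ∈ c.dom.source) (hfq : f q = y) :
    c.slideCoord χ y q = c.dom q := by
  simp [slideCoord, ← c.cod_apply q hq, hfq]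

theorem slideCoord_fst_of_eq_one (hχ : χ q = 1) : (c.slideCoord χ y q).1 = c.cod y := by
  simp [slideCoord, hχ]

theorem contMDiffAt_slideCoord (hχ : ContMDiffAt 𝓘(ℝ, EX) 𝓘(ℝ, ℝ) ∞ χ q)
    (hq : q ∈ c.dom.source) :
    ContMDiffAt 𝓘(ℝ, EX) 𝓘(ℝ, EY × F) ∞ (c.slideCoord χ y) q := by
  have hdom := c.contMDiffAt_dom q hq
  have hfst : ContMDiffAt 𝓘(ℝ, EX) 𝓘(ℝ, EY) ∞ (fun q => (c.dom q).1) q :=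
    (contDiff_fst.contMDiff.contMDiffAt (x := c.dom q)).comp q hdom
  exact hdom.add ((hχ.smul (contMDiffAt_const.sub hfst)).prodMk_space contMDiffAt_const)

theorem slide_eq_self (hfq : f q = y) : c.slide χ y q = q := by
  by_cases hq : q ∈ c.dom.source
  · rw [slide_of_mem hq, slideCoord_eq_dom hq hfq, c.dom.left_inv hq]
  · exact if_neg hq

theorem slide_of_eq_zero (hχ : χ q = 0) : c.slide χ y q = q := by
  by_cases hq : q ∈ c.dom.source
  · rw [slide_of_mem hq, slideCoord, hχ, zero_smul, Prod.mk_zero_zero, add_zero, c.dom.left_inv hq]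
  · exact if_neg hq

theorem eventually_slideCoord_mem_target (hχ : ContMDiff 𝓘(ℝ, EX) 𝓘(ℝ, ℝ) ∞ χ)
    (hp : p ∈ c.dom.source) (hfp : f p = y) : ∀ᶠ q in 𝓝 p, c.slideCoord χ y q ∈ c.dom.target :=
  (contMDiffAt_slideCoord hχ.contMDiffAt hp).continuousAt.eventually_mem <| by
    rw [slideCoord_eq_dom hp hfp]
    exact c.dom.open_target.mem_nhds (c.dom.map_source hp)

theorem isFiberRetractionNear_slide (hχ : ContMDiff 𝓘(ℝ, EX) 𝓘(ℝ, ℝ) ∞ χ)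
    (hsupp : tsupport χ ⊆ c.dom.source) :
    IsFiberRetractionNear EX f y {p | χ =ᶠ[𝓝 p] 1} (c.slide χ y) where
  eq_self _ := slide_eq_self
  eventually_contMDiffAt p hp := by
    by_cases hpχ : p ∈ tsupport χ
    · filter_upwards [c.dom.open_source.eventually_mem (hsupp hpχ),
        eventually_slideCoord_mem_target hχ (hsupp hpχ) hp] with q hq hqt
      refine ((c.contMDiffAt_dom_symm _ hqt).comp q
        (contMDiffAt_slideCoord hχ.contMDiffAt hq)).congr_of_eventuallyEq ?_
      filter_upwards [c.dom.open_source.mem_nhds hq] with q' hq' using slide_of_mem hq'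
    · filter_upwards [(notMem_tsupport_iff_eventuallyEq.1 hpχ).eventuallyEq_nhds] with q hq
      exact contMDiffAt_id.congr_of_eventuallyEq (hq.mono fun q' hq' => slide_of_eq_zero hq')
  eventually_map_eq p hpχ hp := by
    have hps : p ∈ c.dom.source := hsupp (subset_tsupport _ (by simp [hpχ.self_of_nhds]))
    filter_upwards [c.dom.open_source.mem_nhds hps, hpχ,
      eventually_slideCoord_mem_target hχ hps hp] with q hq hqχ hqt
    rw [slide_of_mem hq]
    exact map_symm_eq hqt (hp ▸ c.mapsTo hps) (slideCoord_fst_of_eq_one hqχ)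

end SubmersionChart

theorem exists_isFiberRetractionNear [FiniteDimensional ℝ EX] [T2Space X] [IsManifold 𝓘(ℝ, EX) ∞ X]
    (hf : Manifold.IsSubmersion 𝓘(ℝ, EX) 𝓘(ℝ, EY) ∞ f) {K : Set X} (hK : IsCompact K) (y : Y) :
    ∃ ρ : X → X, IsFiberRetractionNear EX f y K ρ := by
  refine hK.induction_on (p := fun K => ∃ ρ : X → X, IsFiberRetractionNear EX f y K ρ)
    ⟨id, .id⟩ (fun K L hKL ⟨ρ, hρ⟩ => ⟨ρ, hρ.mono hKL⟩)
    (fun K L ⟨ρ₁, h₁⟩ ⟨ρ₂, h₂⟩ => ⟨ρ₂ ∘ ρ₁, h₂.comp h₁⟩) fun p _ => ?_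
  obtain ⟨F, _, _, c, hp⟩ := exists_submersionChart hf p
  obtain ⟨χ, -, hχ⟩ := (SmoothBumpFunction.nhds_basis_tsupport (I := 𝓘(ℝ, EX)) p).mem_iff.1
    (c.dom.open_source.mem_nhds hp)
  exact ⟨{q | χ =ᶠ[𝓝 q] 1}, mem_nhdsWithin_of_mem_nhds χ.eventuallyEq_one.eventuallyEq_nhds,
    c.slide χ y, SubmersionChart.isFiberRetractionNear_slide χ.contMDiff hχ⟩

end Submersion

section Ehresmann

variable {EX EY F X Y : Type*}
  [NormedAddCommGroup EX] [NormedSpace ℝ EX] [NormedAddCommGroup EY] [NormedSpace ℝ EY]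
  [NormedAddCommGroup F] [NormedSpace ℝ F]
  [TopologicalSpace X] [ChartedSpace EX X] [TopologicalSpace Y] [ChartedSpace EY Y]
  {f : X → Y} {y : Y} {p : X}

namespace SubmersionChart

variable {c : SubmersionChart EX EY F f} {K : Set X} {ρ : X → X}

theorem eventually_contMDiffAt_prodMk_cod_snd_dom (hp : p ∈ c.dom.source) (hfp : f p = y) :
    ∀ᶠ z : X × Y in 𝓝 (p, y), ContMDiffAt (𝓘(ℝ, EX).prod 𝓘(ℝ, EY)) 𝓘(ℝ, EY × F) ∞
      (fun z : X × Y => (c.cod z.2, (c.dom z.1).2)) z := by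
  filter_upwards [prod_mem_nhds (c.dom.open_source.mem_nhds hp)
    (c.cod.open_source.mem_nhds (hfp ▸ c.mapsTo hp))] with z hz
  have hcod : ContMDiffAt (𝓘(ℝ, EX).prod 𝓘(ℝ, EY)) 𝓘(ℝ, EY) ∞ (fun z : X × Y => c.cod z.2) z :=
    (c.contMDiffAt_cod z.2 hz.2).comp z contMDiffAt_snd
  have hdom : ContMDiffAt (𝓘(ℝ, EX).prod 𝓘(ℝ, EY)) 𝓘(ℝ, EY × F) ∞ (fun z : X × Y => c.dom z.1) z :=
    (c.contMDiffAt_dom z.1 hz.1).comp z contMDiffAt_fst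
  exact hcod.prodMk_space (contDiff_snd.contMDiff.contMDiffAt.comp z hdom)

theorem exists_inverse_snd_retraction [CompleteSpace EX] (hp : p ∈ c.dom.source) (hfp : f p = y)
    (hρ : IsFiberRetractionNear EX f y K ρ) :
    ∃ ψ : EY × F → F, ψ (c.dom p) = (c.dom p).2 ∧ ∀ᶠ w in 𝓝 (c.dom p), ContDiffAt ℝ ∞ ψ w ∧
      (c.dom (ρ (c.dom.symm (w.1, ψ w)))).2 = w.2 ∧
      ψ (w.1, (c.dom (ρ (c.dom.symm w))).2) = w.2 := by
  have := c.completeSpace_prod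
  have : CompleteSpace EY := .fst_of_prod (β := F)
  have : CompleteSpace F := .snd_of_prod (α := EY)
  have hsymm : Tendsto c.dom.symm (𝓝 (c.dom p)) (𝓝 p) := c.dom.tendsto_symm hp
  have htarget : ∀ᶠ w in 𝓝 (c.dom p), w ∈ c.dom.target :=
    c.dom.open_target.mem_nhds (c.dom.map_source hp)
  refine exists_contDiffAt_inverse_snd (g := fun w => (c.dom (ρ (c.dom.symm w))).2) ?_ (by simp) ?_
  · filter_upwards [hsymm.eventually (hρ.eventually_contMDiffAt p hfp),
      ((hρ.tendsto hfp).comp hsymm).eventually_mem (c.dom.open_source.mem_nhds hp), htarget]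
      with w hρw hρws hw
    exact ((c.contMDiffAt_dom _ hρws).comp w
      (hρw.comp w (c.contMDiffAt_dom_symm w hw))).contDiffAt.snd
  · have hline : Tendsto (fun v => ((c.dom p).1, v)) (𝓝 (c.dom p).2) (𝓝 (c.dom p)) :=
      (Continuous.prodMk_right (c.dom p).1).tendsto _
    filter_upwards [hline.eventually htarget] with v hv
    have hfv : f (c.dom.symm ((c.dom p).1, v)) = y :=
      map_symm_eq hv (hfp ▸ c.mapsTo hp) (by rw [← hfp, c.cod_apply p hp])
    rw [hρ.eq_self _ hfv, c.dom.right_inv hv]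

theorem exists_local_inverse [CompleteSpace EX] (hp : p ∈ c.dom.source) (hfp : f p = y)
    (hρ : IsFiberRetractionNear EX f y K ρ) (hpK : p ∈ K) :
    ∃ Θ : X × Y → X, (∀ᶠ q in 𝓝 p, Θ (ρ q, f q) = q) ∧
      ∀ᶠ z in 𝓝 (p, y), ContMDiffAt (𝓘(ℝ, EX).prod 𝓘(ℝ, EY)) 𝓘(ℝ, EX) ∞ Θ z ∧
        (f z.1 = y → (ρ (Θ z), f (Θ z)) = z) := by
  obtain ⟨ψ, hψp, hψ⟩ := exists_inverse_snd_retraction hp hfp hρ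
  -- In the chart, `f` dictates the first coordinate of a preimage of `z` under `(ρ, f)`, and `ψ`
  -- solves for the second one.
  let u : X × Y → EY × F := fun z => (c.cod z.2, (c.dom z.1).2)
  have husmooth := eventually_contMDiffAt_prodMk_cod_snd_dom (c := c) hp hfp
  have hu : Tendsto u (𝓝 (p, y)) (𝓝 (c.dom p)) := by
    rw [← prodMk_cod_snd_dom hp hfp]
    exact husmooth.self_of_nhds.continuousAt
  have hψlim : Tendsto (fun w => (w.1, ψ w)) (𝓝 (c.dom p)) (𝓝 (c.dom p)) := by
    simpa only [ContinuousAt, hψp] using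
      continuousAt_fst.prodMk hψ.self_of_nhds.1.continuousAt
  have hΘlim : Tendsto (fun z => c.dom.symm ((u z).1, ψ (u z))) (𝓝 (p, y)) (𝓝 p) :=
    (c.dom.tendsto_symm hp).comp (hψlim.comp hu)
  refine ⟨fun z => c.dom.symm ((u z).1, ψ (u z)), ?_, ?_⟩
  · filter_upwards [(c.dom.continuousAt hp).tendsto.eventually hψ, c.dom.open_source.mem_nhds hp]
      with q ⟨_, _, hψq⟩ hq
    rw [c.dom.left_inv hq] at hψq
    simp only [u, c.cod_apply q hq, hψq, c.dom.left_inv hq]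
  · filter_upwards [husmooth, hu.eventually hψ,
      (hψlim.comp hu).eventually_mem (c.dom.open_target.mem_nhds (c.dom.map_source hp)),
      hΘlim.eventually (hρ.eventually_map_eq p hpK hfp),
      ((hρ.tendsto hfp).comp hΘlim).eventually_mem (c.dom.open_source.mem_nhds hp),
      prod_mem_nhds (c.dom.open_source.mem_nhds hp)
        (c.cod.open_source.mem_nhds (hfp ▸ c.mapsTo hp))]
      with z huz ⟨hψz, hsnd, _⟩ hzt hρz hρzs ⟨hz₁, hz₂⟩
    refine ⟨(c.contMDiffAt_dom_symm _ hzt).comp z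
      ((contDiffAt_fst.prodMk hψz).contMDiffAt.comp z huz), fun hfz => Prod.ext ?_ ?_⟩
    · exact eq_of_map_eq_of_snd_eq hρzs hz₁ (hρz.trans hfz.symm) hsnd
    · exact map_symm_eq hzt hz₂ rfl

end SubmersionChart

theorem exists_local_inverse_of_isFiberRetractionNear [CompleteSpace EX]
    (hf : Manifold.IsSubmersion 𝓘(ℝ, EX) 𝓘(ℝ, EY) ∞ f) {K : Set X} {ρ : X → X}
    (hρ : IsFiberRetractionNear EX f y K ρ) (hpK : p ∈ K) (hfp : f p = y) :
    ∃ Θ : X × Y → X, (∀ᶠ q in 𝓝 p, Θ (ρ q, f q) = q) ∧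
      ∀ᶠ z in 𝓝 (p, y), ContMDiffAt (𝓘(ℝ, EX).prod 𝓘(ℝ, EY)) 𝓘(ℝ, EX) ∞ Θ z ∧
        (f z.1 = y → (ρ (Θ z), f (Θ z)) = z) := by
  obtain ⟨F, _, _, c, hp⟩ := exists_submersionChart hf p
  exact c.exists_local_inverse hp hfp hρ hpK

end Ehresmann

section FiberTrivialization

variable {EX EY X Y : Type*}
  [NormedAddCommGroup EX] [NormedSpace ℝ EX] [NormedAddCommGroup EY] [NormedSpace ℝ EY]
  [TopologicalSpace X] [ChartedSpace EX X] [TopologicalSpace Y] [ChartedSpace EY Y]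
  {f : X → Y} {y : Y} {ρ : X → X}

theorem exists_mem_nhdsSet_fiber_injOn_prodMk [CompleteSpace EX] [T2Space X] [T2Space Y]
    (hf : Manifold.IsSubmersion 𝓘(ℝ, EX) 𝓘(ℝ, EY) ∞ f) (hF : IsCompact (f ⁻¹' {y}))
    (hρ : IsFiberRetractionNear EX f y (f ⁻¹' {y}) ρ) :
    ∃ U ∈ 𝓝ˢ (f ⁻¹' {y}), InjOn (fun q => (ρ q, f q)) U := by
  refine InjOn.exists_mem_nhdsSet (fun q hq q' hq' heq => ?_) hF (fun p hp => ?_) fun p hp => ?_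
  · rw [← hρ.eq_self q hq, ← hρ.eq_self q' hq']
    exact congrArg Prod.fst heq
  · exact (hρ.eventually_contMDiffAt p hp).self_of_nhds.continuousAt.prodMk
      hf.contMDiff.continuous.continuousAt
  · obtain ⟨Θ, hΘ, -⟩ := exists_local_inverse_of_isFiberRetractionNear hf hρ hp hp
    exact ⟨_, hΘ, LeftInvOn.injOn (f₁' := Θ) fun q hq => hq⟩

theorem eventually_forall_fiber_exists_local_inverse [CompleteSpace EX]
    (hf : Manifold.IsSubmersion 𝓘(ℝ, EX) 𝓘(ℝ, EY) ∞ f) (hF : IsCompact (f ⁻¹' {y}))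
    (hρ : IsFiberRetractionNear EX f y (f ⁻¹' {y}) ρ) :
    ∀ᶠ v in 𝓝 y, ∀ p ∈ f ⁻¹' {y}, ∃ Θ : X × Y → X,
      ContMDiffAt (𝓘(ℝ, EX).prod 𝓘(ℝ, EY)) 𝓘(ℝ, EX) ∞ Θ (p, v) ∧
      ∀ᶠ z in 𝓝 (p, v), f z.1 = y → (ρ (Θ z), f (Θ z)) = z := by
  refine hF.eventually_forall_of_forall_eventually fun p hp => ?_
  obtain ⟨Θ, -, hΘ⟩ := exists_local_inverse_of_isFiberRetractionNear hf hρ hp hp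
  have hswap : Tendsto Prod.swap (𝓝 (y, p)) (𝓝 (p, y)) := continuous_swap.tendsto (y, p)
  filter_upwards [hswap.eventually hΘ.eventually_nhds] with z hz
  exact ⟨Θ, hz.self_of_nhds.1, hz.mono fun _ h => h.2⟩

theorem exists_contMDiffOn_invOn_fiber_prod {V : Set Y}
    (hinj : InjOn (fun q => (ρ q, f q)) (f ⁻¹' V))
    (hmaps : MapsTo (fun q => (ρ q, f q)) (f ⁻¹' V) ((f ⁻¹' {y}) ×ˢ V))
    (hloc : ∀ v ∈ V, ∀ p ∈ f ⁻¹' {y}, ∃ Θ : X × Y → X,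
      ContMDiffAt (𝓘(ℝ, EX).prod 𝓘(ℝ, EY)) 𝓘(ℝ, EX) ∞ Θ (p, v) ∧
      ∀ᶠ z in 𝓝 (p, v), f z.1 = y → (ρ (Θ z), f (Θ z)) = z) :
    ∃ Φ : X × Y → X,
      ContMDiffOn (𝓘(ℝ, EX).prod 𝓘(ℝ, EY)) 𝓘(ℝ, EX) ∞ Φ ((f ⁻¹' {y}) ×ˢ V) ∧
      MapsTo Φ ((f ⁻¹' {y}) ×ˢ V) (f ⁻¹' V) ∧
      InvOn Φ (fun q => (ρ q, f q)) (f ⁻¹' V) ((f ⁻¹' {y}) ×ˢ V) := by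
  rcases isEmpty_or_nonempty X with hX | hX
  · exact ⟨Prod.fst, fun z => isEmptyElim z.1, fun z => isEmptyElim z.1,
      isEmptyElim, fun z => isEmptyElim z.1⟩
  refine exists_contMDiffOn_invOn hinj hmaps fun z ⟨hz₁, hz₂⟩ => ?_
  obtain ⟨Θ, hΘs, hΘ⟩ := hloc z.2 hz₂ z.1 hz₁
  refine ⟨Θ, hΘs.contMDiffWithinAt, ?_⟩
  filter_upwards [self_mem_nhdsWithin, mem_nhdsWithin_of_mem_nhds hΘ] with z' ⟨hz'₁, hz'₂⟩ hΘz'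
  have hright : (ρ (Θ z'), f (Θ z')) = z' := hΘz' hz'₁
  have hmap : f (Θ z') = z'.2 := congrArg Prod.snd hright
  exact ⟨mem_preimage.2 (hmap ▸ hz'₂), hright⟩

theorem ProperAt.locallyTrivialAt [FiniteDimensional ℝ EX] [T2Space X]
    [SecondCountableTopology X] [IsManifold 𝓘(ℝ, EX) ∞ X] [T2Space Y] [FirstCountableTopology Y]
    (h : ProperAt f y) (hf : Manifold.IsSubmersion 𝓘(ℝ, EX) 𝓘(ℝ, EY) ∞ f) :
    LocallyTrivialAt EX EY f y := by
  have : LocallyCompactSpace X := ChartedSpace.locallyCompactSpace EX X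
  have : CompleteSpace EX := FiniteDimensional.complete ℝ EX
  have hfc : Continuous f := hf.contMDiff.continuous
  have hF : IsCompact (f ⁻¹' {y}) := h.isCompact_fiber hfc
  obtain ⟨ρ, hρ⟩ := exists_isFiberRetractionNear hf hF y
  obtain ⟨U, hU, hinj⟩ := exists_mem_nhdsSet_fiber_injOn_prodMk hf hF hρ
  have hnear : ∀ᶠ q in 𝓝ˢ (f ⁻¹' {y}),
      q ∈ U ∧ ContMDiffAt 𝓘(ℝ, EX) 𝓘(ℝ, EX) ∞ ρ q ∧ f (ρ q) = y :=
    Filter.Eventually.and hU (eventually_nhdsSet_iff_forall.2 fun p hp =>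
      (hρ.eventually_contMDiffAt p hp).and (hρ.eventually_map_eq p hp hp))
  obtain ⟨V, hV, hVo, hyV⟩ := eventually_nhds_iff.1 ((h.eventually_forall_fiber hfc hnear).and
    (eventually_forall_fiber_exists_local_inverse hf hF hρ))
  have hmaps : MapsTo (fun q => (ρ q, f q)) (f ⁻¹' V) ((f ⁻¹' {y}) ×ˢ V) :=
    fun q hq => ⟨((hV _ hq).1 q rfl).2.2, hq⟩
  have hinjV : InjOn (fun q => (ρ q, f q)) (f ⁻¹' V) :=
    hinj.mono fun q hq => ((hV _ hq).1 q rfl).1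
  obtain ⟨Φ, hΦ, hΦmaps, hΦinv⟩ :=
    exists_contMDiffOn_invOn_fiber_prod hinjV hmaps fun v hv => (hV v hv).2
  exact ⟨V, hVo, hyV, fun q => (ρ q, f q), Φ,
    fun q hq => (((hV _ hq).1 q rfl).2.1.prodMk hf.contMDiff.contMDiffAt).contMDiffWithinAt,
    hΦ, hmaps, hΦmaps, hΦinv, fun _ _ => rfl⟩

end FiberTrivialization

namespace LieGroupoid

variable {EG EM G M : Type*}
  [NormedAddCommGroup EG] [NormedSpace ℝ EG] [NormedAddCommGroup EM] [NormedSpace ℝ EM]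
  [TopologicalSpace G] [ChartedSpace EG G] [TopologicalSpace M] [ChartedSpace EM M]
  (𝒢 : LieGroupoid EG EM G M) {x : M}

theorem continuous_src : Continuous 𝒢.src := 𝒢.src_submersion.contMDiff.continuous

theorem continuous_tgt : Continuous 𝒢.tgt := 𝒢.tgt_submersion.contMDiff.continuous

theorem continuous_anchor : Continuous 𝒢.anchor := 𝒢.continuous_tgt.prodMk 𝒢.continuous_src

theorem isOpenMap_tgt : IsOpenMap 𝒢.tgt := isOpenMap_of_isSubmersion 𝒢.tgt_submersion

theorem tendsto_mul {ι : Type*} {l : Filter ι} {a b : ι → G} {g h : G} (ha : Tendsto a l (𝓝 g))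
    (hb : Tendsto b l (𝓝 h)) (hgh : 𝒢.src g = 𝒢.tgt h)
    (hab : ∀ᶠ i in l, 𝒢.src (a i) = 𝒢.tgt (b i)) :
    Tendsto (fun i => 𝒢.mul (a i) (b i)) l (𝓝 (𝒢.mul g h)) :=
  (𝒢.mul_smooth.continuousOn (g, h) hgh).tendsto.comp
    (tendsto_nhdsWithin_iff.2 ⟨ha.prodMk_nhds hb, hab⟩)

theorem inv_mul_cancel_left {g h : G} (hgh : 𝒢.tgt g = 𝒢.tgt h) :
    𝒢.mul g (𝒢.mul (𝒢.inv g) h) = h := by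
  rw [← 𝒢.mul_assoc _ _ _ (𝒢.tgt_inv g).symm ((𝒢.src_inv g).trans hgh), 𝒢.mul_inv, hgh,
    𝒢.unit_mul]

theorem self_mem_orbit (x : M) : x ∈ 𝒢.orbit x := ⟨𝒢.unit x, 𝒢.src_unit x, 𝒢.tgt_unit x⟩

theorem tgt_mem_orbit {g : G} (h : 𝒢.src g ∈ 𝒢.orbit x) : 𝒢.tgt g ∈ 𝒢.orbit x := by
  obtain ⟨k, hk, hkg⟩ := h
  exact ⟨𝒢.mul g k, (𝒢.src_mul _ _ hkg.symm).trans hk, 𝒢.tgt_mul _ _ hkg.symm⟩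

theorem exists_arrow_of_mem_orbit {z w : M} (hz : z ∈ 𝒢.orbit x) (hw : w ∈ 𝒢.orbit x) :
    ∃ g, 𝒢.src g = w ∧ 𝒢.tgt g = z := by
  obtain ⟨h, hx, rfl⟩ := hz
  obtain ⟨k, kx, rfl⟩ := hw
  have hhk : 𝒢.src h = 𝒢.tgt (𝒢.inv k) := by rw [𝒢.tgt_inv, kx]; exact hx
  exact ⟨𝒢.mul h (𝒢.inv k), by rw [𝒢.src_mul _ _ hhk, 𝒢.src_inv], 𝒢.tgt_mul _ _ hhk⟩

section Saturation

/-- The *saturation* of a set `W` of objects: the targets of the arrows with source in `W`, which is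
the union of the orbits that meet `W`. -/
def saturation (W : Set M) : Set M := 𝒢.tgt '' (𝒢.src ⁻¹' W)

theorem isOpen_saturation {W : Set M} (hW : IsOpen W) : IsOpen (𝒢.saturation W) :=
  𝒢.isOpenMap_tgt _ (hW.preimage 𝒢.continuous_src)

theorem orbit_subset_saturation {W : Set M} (hx : x ∈ W) : 𝒢.orbit x ⊆ 𝒢.saturation W :=
  image_mono fun _ hg => mem_preimage.2 (mem_of_eq_of_mem hg hx)

theorem saturated_saturation (W : Set M) : 𝒢.Saturated (𝒢.saturation W) := by
  rintro _ ⟨g, hg, rfl⟩ _ ⟨k, hk, rfl⟩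
  exact ⟨𝒢.mul k g, mem_preimage.2 (by rwa [𝒢.src_mul _ _ hk]), 𝒢.tgt_mul _ _ hk⟩

theorem saturation_eq_orbit {W : Set M} (hW : W.Nonempty) (hWx : W ⊆ 𝒢.orbit x) :
    𝒢.saturation W = 𝒢.orbit x := by
  obtain ⟨w, hw⟩ := hW
  refine Subset.antisymm ?_ fun z hz => ?_
  · rintro _ ⟨g, hg, rfl⟩
    exact 𝒢.tgt_mem_orbit (hWx hg)
  · obtain ⟨g, rfl, rfl⟩ := 𝒢.exists_arrow_of_mem_orbit hz (hWx hw)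
    exact ⟨g, hw, rfl⟩

theorem isOpen_orbit_of_interior_nonempty (h : (interior (𝒢.orbit x)).Nonempty) :
    IsOpen (𝒢.orbit x) :=
  𝒢.saturation_eq_orbit h interior_subset ▸ 𝒢.isOpen_saturation isOpen_interior

theorem dense_tgt_notMem_orbit (h : ¬ IsOpen (𝒢.orbit x)) : Dense {g | 𝒢.tgt g ∉ 𝒢.orbit x} := by
  have hint : interior (𝒢.orbit x) = ∅ :=
    not_nonempty_iff_eq_empty.1 (mt 𝒢.isOpen_orbit_of_interior_nonempty h)
  exact (interior_eq_empty_iff_dense_compl.1 hint).preimage 𝒢.isOpenMap_tgt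

theorem IsSProperAt.orbitStable [FirstCountableTopology M] [T2Space M]
    {𝒢 : LieGroupoid EG EM G M} (h : 𝒢.IsSProperAt x) : 𝒢.OrbitStable x := by
  intro U hU hxU
  have htgt : ∀ᶠ g in 𝓝ˢ (𝒢.src ⁻¹' {x}), 𝒢.tgt g ∈ U :=
    (hU.preimage 𝒢.continuous_tgt).mem_nhdsSet.2 fun g hg => hxU ⟨g, hg, rfl⟩
  obtain ⟨W, hW, hWo, hxW⟩ := eventually_nhds_iff.1
    (ProperAt.eventually_forall_fiber h 𝒢.continuous_src htgt)
  refine ⟨𝒢.saturation W, 𝒢.isOpen_saturation hWo, 𝒢.saturated_saturation W,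
    𝒢.orbit_subset_saturation hxW, ?_⟩
  rintro _ ⟨g, hg, rfl⟩
  exact hW _ hg g rfl

end Saturation

section Compactness

theorem surjective_toOrbit (x : M) : Function.Surjective (𝒢.toOrbit x) := by
  rintro ⟨_, g, hg, rfl⟩
  exact ⟨⟨g, hg⟩, rfl⟩

theorem isCompact_orbit (h : 𝒢.OrbitCompact x) : IsCompact (𝒢.orbit x) := by
  let := 𝒢.orbitTopology x
  have : CompactSpace (𝒢.orbit x) := h
  have hval : Continuous (Subtype.val : 𝒢.orbit x → M) :=
    continuous_coinduced_dom.2 (𝒢.continuous_tgt.comp continuous_subtype_val)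
  simpa only [Subtype.range_coe] using isCompact_range hval

theorem orbitCompact_of_isCompact_sFiber (h : IsCompact (𝒢.sFiber x)) : 𝒢.OrbitCompact x := by
  have : CompactSpace (𝒢.sFiber x) := isCompact_iff_compactSpace.1 h
  let := 𝒢.orbitTopology x
  exact (𝒢.surjective_toOrbit x).compactSpace continuous_coinduced_rng

theorem isCompact_isotropy_of_isCompact_sFiber [T1Space M] (h : IsCompact (𝒢.sFiber x)) :
    IsCompact (𝒢.isotropy x) :=
  h.inter_right (isClosed_singleton.preimage 𝒢.continuous_tgt)

theorem src_eq_tgt_of_mem_isotropy {g h : G} (hg : g ∈ 𝒢.sFiber x) (hh : h ∈ 𝒢.isotropy x) :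
    𝒢.src g = 𝒢.tgt h :=
  Eq.trans hg hh.2.symm

/-- The right action of the isotropy group on the `s`-fibre, whose orbit space is `O_x`. -/
def mulIsotropy (x : M) (p : 𝒢.sFiber x × 𝒢.isotropy x) : 𝒢.sFiber x :=
  ⟨𝒢.mul p.1 p.2,
    (𝒢.src_mul _ _ (𝒢.src_eq_tgt_of_mem_isotropy p.1.2 p.2.2)).trans p.2.2.1⟩

theorem continuous_mulIsotropy (x : M) : Continuous (𝒢.mulIsotropy x) :=
  Continuous.subtype_mk (continuous_iff_continuousAt.2 fun p =>
    𝒢.tendsto_mul (continuous_subtype_val.comp continuous_fst).continuousAt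
      (continuous_subtype_val.comp continuous_snd).continuousAt
      (𝒢.src_eq_tgt_of_mem_isotropy p.1.2 p.2.2)
      (Eventually.of_forall fun q => 𝒢.src_eq_tgt_of_mem_isotropy q.1.2 q.2.2)) _

theorem toOrbit_eq_iff {g k : 𝒢.sFiber x} :
    𝒢.toOrbit x g = 𝒢.toOrbit x k ↔ ∃ h, 𝒢.mulIsotropy x (g, h) = k := by
  refine ⟨fun hgk => ?_, ?_⟩
  · have htgt : 𝒢.tgt g = 𝒢.tgt k := congrArg Subtype.val hgk
    have hcomp : 𝒢.src (𝒢.inv g) = 𝒢.tgt k := (𝒢.src_inv g).trans htgt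
    exact ⟨⟨𝒢.mul (𝒢.inv g) k, (𝒢.src_mul _ _ hcomp).trans k.2,
      ((𝒢.tgt_mul _ _ hcomp).trans (𝒢.tgt_inv g)).trans g.2⟩,
      Subtype.ext (𝒢.inv_mul_cancel_left htgt)⟩
  · rintro ⟨h, rfl⟩
    exact Subtype.ext (𝒢.tgt_mul _ _ (𝒢.src_eq_tgt_of_mem_isotropy g.2 h.2)).symm

theorem isOpenMap_toOrbit (x : M) : @IsOpenMap _ _ _ (𝒢.orbitTopology x) (𝒢.toOrbit x) := by
  intro U hU
  have hpre : 𝒢.toOrbit x ⁻¹' (𝒢.toOrbit x '' U) =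
      ⋃ h, (fun g => 𝒢.mulIsotropy x (g, h)) ⁻¹' U := by
    ext g
    simp only [mem_preimage, mem_image, mem_iUnion, eq_comm (b := 𝒢.toOrbit x g), toOrbit_eq_iff]
    exact ⟨fun ⟨_, hu, h, hgu⟩ => ⟨h, hgu ▸ hu⟩, fun ⟨h, hu⟩ => ⟨_, hu, h, rfl⟩⟩
  rw [isOpen_coinduced, hpre]
  exact isOpen_iUnion fun h =>
    hU.preimage ((𝒢.continuous_mulIsotropy x).comp (Continuous.prodMk_left h))

theorem isCompact_sFiber [LocallyCompactSpace G] [T1Space M] (hiso : IsCompact (𝒢.isotropy x))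
    (horb : 𝒢.OrbitCompact x) : IsCompact (𝒢.sFiber x) := by
  have hclosed : IsClosed (𝒢.sFiber x) := isClosed_singleton.preimage 𝒢.continuous_src
  have : LocallyCompactSpace (𝒢.sFiber x) :=
    hclosed.isClosedEmbedding_subtypeVal.locallyCompactSpace
  have : CompactSpace (𝒢.isotropy x) := isCompact_iff_compactSpace.1 hiso
  let := 𝒢.orbitTopology x
  have : CompactSpace (𝒢.orbit x) := horb
  obtain ⟨K, hK, hKuniv⟩ :=
    exists_isCompact_image_eq_univ (𝒢.isOpenMap_toOrbit x) (𝒢.surjective_toOrbit x)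
  have huniv : 𝒢.mulIsotropy x '' (K ×ˢ univ) = univ := eq_univ_of_forall fun k => by
    obtain ⟨g, hg, hgk⟩ := eq_univ_iff_forall.1 hKuniv (𝒢.toOrbit x k)
    obtain ⟨h, hh⟩ := 𝒢.toOrbit_eq_iff.1 hgk
    exact ⟨(g, h), ⟨hg, mem_univ h⟩, hh⟩
  rw [isCompact_iff_isCompact_univ, ← huniv]
  exact (hK.prod isCompact_univ).image (𝒢.continuous_mulIsotropy x)

end Compactness

section Properness

variable {𝒢}

theorem IsSProperAt.isProperAt (h : 𝒢.IsSProperAt x) : 𝒢.IsProperAt x :=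
  ProperAt.of_comp (g := Prod.snd) h continuousAt_snd

theorem IsProperAt.properAt_anchor [T2Space M] (h : 𝒢.IsProperAt x) {z : M}
    (hz : z ∈ 𝒢.orbit x) : ProperAt 𝒢.anchor (z, x) := by
  obtain ⟨k, hk, rfl⟩ := hz
  obtain ⟨σ, hσk, hσc, hσ⟩ := exists_local_section_of_isSubmersion 𝒢.tgt_submersion k
  intro a ha
  obtain ⟨htgt, hsrc⟩ : Tendsto (𝒢.tgt ∘ a) atTop (𝓝 (𝒢.tgt k)) ∧
      Tendsto (𝒢.src ∘ a) atTop (𝓝 x) := (Prod.tendsto_iff _ _).1 ha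
  -- `a n` is the product of `u n`, which tends to `k`, and `b n`, whose anchor tends to `(x, x)`.
  let u : ℕ → G := fun n => σ (𝒢.tgt (a n))
  have hu : Tendsto u atTop (𝓝 k) := (hσk ▸ hσc.tendsto).comp htgt
  have htgtu : ∀ᶠ n in atTop, 𝒢.tgt (u n) = 𝒢.tgt (a n) := htgt.eventually hσ
  have hsrcu : Tendsto (𝒢.src ∘ u) atTop (𝓝 x) :=
    Eq.subst (motive := fun w => Tendsto _ _ (𝓝 w)) hk ((𝒢.continuous_src.tendsto k).comp hu)
  let b : ℕ → G := fun n => 𝒢.mul (𝒢.inv (u n)) (a n)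
  have htgtb : ∀ᶠ n in atTop, 𝒢.tgt (b n) = 𝒢.src (u n) := htgtu.mono fun n hn =>
    (𝒢.tgt_mul _ _ ((𝒢.src_inv _).trans hn)).trans (𝒢.tgt_inv _)
  have hsrcb : ∀ᶠ n in atTop, 𝒢.src (b n) = 𝒢.src (a n) := htgtu.mono fun n hn =>
    𝒢.src_mul _ _ ((𝒢.src_inv _).trans hn)
  have hb : Tendsto (𝒢.anchor ∘ b) atTop (𝓝 (x, x)) :=
    (hsrcu.congr' (htgtb.mono fun _ => Eq.symm)).prodMk_nhds
      (hsrc.congr' (hsrcb.mono fun _ => Eq.symm))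
  obtain ⟨p, hp, φ, hφ, hlim⟩ := ProperAt.exists_tendsto_subseq h 𝒢.continuous_anchor hb
  have hkp : 𝒢.src k = 𝒢.tgt p := Eq.trans hk (congrArg Prod.fst hp).symm
  refine ⟨𝒢.mul k p, φ, hφ, ?_⟩
  refine (𝒢.tendsto_mul (hu.comp hφ.tendsto_atTop) hlim hkp ?_).congr' ?_
  · exact (hφ.tendsto_atTop.eventually htgtb).mono fun _ => Eq.symm
  · exact (hφ.tendsto_atTop.eventually htgtu).mono fun _ hn => 𝒢.inv_mul_cancel_left hn

theorem OrbitStable.exists_mapClusterPt_tgt [T1Space M] (h : 𝒢.OrbitStable x) {a : ℕ → G}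
    (hsrc : Tendsto (𝒢.src ∘ a) atTop (𝓝 x)) (ha : ∀ n, 𝒢.tgt (a n) ∉ 𝒢.orbit x) :
    ∃ z ∈ 𝒢.orbit x, MapClusterPt z atTop (𝒢.tgt ∘ a) := by
  suffices ∃ z ∈ 𝒢.orbit x, z ∈ closure (range (𝒢.tgt ∘ a)) by
    obtain ⟨z, hz, hcl⟩ := this
    exact ⟨z, hz, mapClusterPt_atTop_of_mem_closure_range hcl
      fun ⟨n, hn⟩ => ha n (mem_of_eq_of_mem hn hz)⟩
  by_contra! hdisj
  obtain ⟨V, hVo, hV, hxV, hVU⟩ := h _ isClosed_closure.isOpen_compl hdisj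
  obtain ⟨n, hn⟩ := (hsrc.eventually_mem (hVo.mem_nhds (hxV (𝒢.self_mem_orbit x)))).exists
  exact hVU (hV _ hn ⟨a n, rfl, rfl⟩) (subset_closure ⟨n, rfl⟩)

theorem exists_mapClusterPt_tgt_of_isOpen_orbit (hO : IsOpen (𝒢.orbit x))
    (hc : 𝒢.OrbitCompact x) {a : ℕ → G} (hsrc : Tendsto (𝒢.src ∘ a) atTop (𝓝 x)) :
    ∃ z ∈ 𝒢.orbit x, MapClusterPt z atTop (𝒢.tgt ∘ a) := by
  have htgt : ∀ᶠ n in atTop, 𝒢.tgt (a n) ∈ 𝒢.orbit x :=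
    (hsrc.eventually_mem (hO.mem_nhds (𝒢.self_mem_orbit x))).mono fun _ => 𝒢.tgt_mem_orbit
  exact (𝒢.isCompact_orbit hc).exists_mapClusterPt (tendsto_principal.2 htgt)

theorem OrbitStable.exists_mapClusterPt_tgt_of_not_isOpen_orbit
    [TopologicalSpace.MetrizableSpace M] (h : 𝒢.OrbitStable x) (hO : ¬ IsOpen (𝒢.orbit x))
    {a : ℕ → G} (hsrc : Tendsto (𝒢.src ∘ a) atTop (𝓝 x)) :
    ∃ z ∈ 𝒢.orbit x, MapClusterPt z atTop (𝒢.tgt ∘ a) := by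
  let := TopologicalSpace.metrizableSpaceMetric M
  obtain ⟨b, hbO, hb⟩ :=
    exists_seq_mem_tendsto_dist_of_dense (𝒢.dense_tgt_notMem_orbit hO) 𝒢.continuous_anchor a
  have hsrcb : Tendsto (𝒢.src ∘ b) atTop (𝓝 x) :=
    (tendsto_iff_of_dist (squeeze_zero (fun _ => dist_nonneg)
      (fun n => le_max_right _ _) hb)).1 hsrc
  obtain ⟨z, hz, hcl⟩ := h.exists_mapClusterPt_tgt hsrcb hbO
  obtain ⟨φ, hφ, hlim⟩ := hcl.tendsto_subseq
  have htgt : Tendsto (fun n => dist (𝒢.tgt (a n)) (𝒢.tgt (b n))) atTop (𝓝 0) :=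
    squeeze_zero (fun _ => dist_nonneg) (fun n => le_max_left _ _) hb
  have hlima : Tendsto (𝒢.tgt ∘ a ∘ φ) atTop (𝓝 z) :=
    (tendsto_iff_of_dist (htgt.comp hφ.tendsto_atTop)).2 hlim
  exact ⟨z, hz, hlima.mapClusterPt.of_comp hφ.tendsto_atTop⟩

theorem IsProperAt.isSProperAt [TopologicalSpace.MetrizableSpace M] (h : 𝒢.IsProperAt x)
    (hst : 𝒢.OrbitStable x) (hO : IsOpen (𝒢.orbit x) → 𝒢.OrbitCompact x) : 𝒢.IsSProperAt x := by
  intro a hsrc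
  obtain ⟨z, hz, hcl⟩ : ∃ z ∈ 𝒢.orbit x, MapClusterPt z atTop (𝒢.tgt ∘ a) := by
    by_cases hopen : IsOpen (𝒢.orbit x)
    · exact exists_mapClusterPt_tgt_of_isOpen_orbit hopen (hO hopen) hsrc
    · exact hst.exists_mapClusterPt_tgt_of_not_isOpen_orbit hopen hsrc
  obtain ⟨φ, hφ, htgt⟩ := hcl.tendsto_subseq
  obtain ⟨p, φ', hφ', hp⟩ := h.properAt_anchor hz (a ∘ φ)
    (htgt.prodMk_nhds (hsrc.comp hφ.tendsto_atTop))
  exact ⟨p, φ ∘ φ', hφ.comp hφ', hp⟩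

end Properness

end LieGroupoid

theorem mainTheorem8 {EG EM G M : Type*}
    [NormedAddCommGroup EG] [NormedSpace ℝ EG] [FiniteDimensional ℝ EG]
    [NormedAddCommGroup EM] [NormedSpace ℝ EM] [FiniteDimensional ℝ EM]
    [TopologicalSpace G] [T2Space G] [SecondCountableTopology G]
    [ChartedSpace EG G] [IsManifold 𝓘(ℝ, EG) ∞ G]
    [TopologicalSpace M] [T2Space M] [SecondCountableTopology M]
    [ChartedSpace EM M] [IsManifold 𝓘(ℝ, EM) ∞ M]
    (𝒢 : LieGroupoid EG EM G M) (x : M) :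
    List.TFAE [
      𝒢.IsSProperAt x,
      𝒢.IsProperAt x ∧ 𝒢.OrbitStable x ∧ (IsOpen (𝒢.orbit x) → 𝒢.OrbitCompact x),
      𝒢.IsSLocallyTrivialAt x ∧ IsCompact (𝒢.isotropy x) ∧ 𝒢.OrbitCompact x] := by
  have : LocallyCompactSpace G := ChartedSpace.locallyCompactSpace EG G
  have : LocallyCompactSpace M := ChartedSpace.locallyCompactSpace EM M
  have hfib (h : 𝒢.IsSProperAt x) : IsCompact (𝒢.sFiber x) :=
    ProperAt.isCompact_fiber h 𝒢.continuous_src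
  tfae_have 1 → 2 := fun h =>
    ⟨h.isProperAt, h.orbitStable, fun _ => 𝒢.orbitCompact_of_isCompact_sFiber (hfib h)⟩
  tfae_have 2 → 1 := fun ⟨h, hst, hop⟩ => h.isSProperAt hst hop
  tfae_have 1 → 3 := fun h =>
    ⟨ProperAt.locallyTrivialAt h 𝒢.src_submersion,
      𝒢.isCompact_isotropy_of_isCompact_sFiber (hfib h),
      𝒢.orbitCompact_of_isCompact_sFiber (hfib h)⟩
  tfae_have 3 → 1 := fun ⟨hlt, hiso, horb⟩ =>
    LocallyTrivialAt.properAt hlt (𝒢.isCompact_sFiber hiso horb)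
  tfae_finish
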